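/- Let $S\subseteq\mathbb{R}^n$ be compact and Zariski dense (that is, $S$ is not contained in the zero set of a nonzero polynomial), and let $\Phi\colon\mathbb{R}[X_1,\dots,X_n]\to\mathbb{R}[X_1,\dots,X_n]$ be a linear map that is an $S$-nonnegativity preserver: whenever $p\ge 0$ on $S$, also $\Phi(p)\ge 0$ on $S$. Let $\widetilde{\Phi}$ be the unique continuous linear extension of $\Phi$ to the Banach space $C(S)$ of continuous real-valued functions on $S$ with the supremum norm, in which the polynomials are dense. Let $\mathcal{M}_+(S)$ be the set of nonnegative Borel measures on $S$ with all finite moments, and let $\Phi^*\colon\mathcal{M}_+(S)\to\mathcal{M}_+(S)$ be the unique adjoint map to $\Phi$, i.e. the unique map with $\int_S\Phi(p)\,d\mu=\int_S p\,d\Phi^*(\mu)$ for all polynomials $p$ and all $\mu\in\mathcal{M}_+(S)$. For $x\in S$ put $\mu_x:=\Phi^*(\delta_x)$, where $\delta_x$ is the Dirac measure at $x$, and for a Borel set $A\subseteq S$ let $\Phi^*_A\colon S\to[0,\infty)$, $x\mapsto\mu_x(A)$. Then the following are equivalent: (i) for every Borel set $A\subseteq S$ the function $\Phi^*_A$ is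 continuous on $S$; (ii) $\widetilde{\Phi}$ is a weakly compact operator on $C(S)$, i.e. the closure, in the weak topology of $C(S)$, of the image under $\widetilde{\Phi}$ of the closed unit ball of $C(S)$ is weakly compact. -/

import Mathlib

open MeasureTheory

namespace NonnegPreserver

/-- `Φ` maps polynomials that are nonnegative on `S` to polynomials that are nonnegative on `S`. -/
def IsNonnegativityPreserver {n : ℕ} (S : Set (Fin n → ℝ))
    (Φ : MvPolynomial (Fin n) ℝ →ₗ[ℝ] MvPolynomial (Fin n) ℝ) : Prop :=
  ∀ p : MvPolynomial (Fin n) ℝ, (∀ x ∈ S, 0 ≤ MvPolynomial.eval x p) →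
    ∀ x ∈ S, 0 ≤ MvPolynomial.eval x (Φ p)

/-- `S` is not contained in the zero set of a nonzero polynomial. -/
def IsZariskiDense {n : ℕ} (S : Set (Fin n → ℝ)) : Prop :=
  ∀ p : MvPolynomial (Fin n) ℝ, p ≠ 0 → ¬ S ⊆ {x | MvPolynomial.eval x p = 0}

/-- The restriction of polynomials to continuous functions on `S`. -/
noncomputable def restrict {n : ℕ} (S : Set (Fin n → ℝ)) : MvPolynomial (Fin n) ℝ →ₐ[ℝ] C(S, ℝ) where
  toFun p := ⟨fun x => MvPolynomial.eval x.1 p,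
    (MvPolynomial.continuous_eval p).comp continuous_subtype_val⟩
  map_one' := by ext; simp
  map_mul' p q := by ext; simp
  map_zero' := by ext; simp
  map_add' p q := by ext; simp
  commutes' r := by ext; simp

@[simp]
theorem restrict_apply {n : ℕ} (S : Set (Fin n → ℝ)) (p : MvPolynomial (Fin n) ℝ) (x : S) :
    restrict S p x = MvPolynomial.eval x.1 p := rfl

/-- The extension of `Φ` to a continuous linear operator on `C(S)`, along the dense map
`restrict S`. -/
noncomputable def extension {n : ℕ} (S : Set (Fin n → ℝ)) [CompactSpace S]
    (Φ : MvPolynomial (Fin n) ℝ →ₗ[ℝ] MvPolynomial (Fin n) ℝ) : C(S, ℝ) →L[ℝ] C(S, ℝ) :=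
  ((restrict S).toLinearMap ∘ₗ Φ).extendOfNorm (restrict S).toLinearMap

theorem separatesPoints_range_restrict {n : ℕ} (S : Set (Fin n → ℝ)) :
    (restrict S).range.SeparatesPoints := by
  intro x y hxy
  obtain ⟨i, hi⟩ : ∃ i, x.1 i ≠ y.1 i := by
    by_contra! h
    exact hxy (Subtype.ext (funext h))
  refine ⟨_, ⟨restrict S (MvPolynomial.X i), ⟨_, rfl⟩, rfl⟩, ?_⟩
  simpa using hi

theorem denseRange_restrict {n : ℕ} (S : Set (Fin n → ℝ)) [CompactSpace S] :
    DenseRange (restrict S).toLinearMap := by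
  have h := ContinuousMap.subalgebra_topologicalClosure_eq_top_of_separatesPoints
    (restrict S).range (separatesPoints_range_restrict S)
  intro f
  have hf : f ∈ (restrict S).range.topologicalClosure := by rw [h]; trivial
  simpa [← SetLike.mem_coe, Subalgebra.topologicalClosure_coe] using hf

theorem norm_restrict_le {n : ℕ} {S : Set (Fin n → ℝ)} [CompactSpace S]
    {Φ : MvPolynomial (Fin n) ℝ →ₗ[ℝ] MvPolynomial (Fin n) ℝ}
    (hΦ : IsNonnegativityPreserver S Φ) (p : MvPolynomial (Fin n) ℝ) :
    ‖((restrict S).toLinearMap ∘ₗ Φ) p‖ ≤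
      ‖restrict S (Φ 1)‖ * ‖(restrict S).toLinearMap p‖ := by
  refine (ContinuousMap.norm_le _ (by positivity)).2 fun x => ?_
  set c := ‖(restrict S).toLinearMap p‖ with hc
  have hp : ∀ y ∈ S, |MvPolynomial.eval y p| ≤ c := fun y hy =>
    (restrict S p).norm_coe_le_norm ⟨y, hy⟩
  have h1 := hΦ (c • 1 - p) (fun y hy => by
    have := abs_le.1 (hp y hy); simp [MvPolynomial.smul_eval]; linarith) x x.2
  have h2 := hΦ (c • 1 + p) (fun y hy => by
    have := abs_le.1 (hp y hy); simp [MvPolynomial.smul_eval]; linarith) x x.2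
  rw [map_sub, map_smul, map_sub, MvPolynomial.smul_eval] at h1
  rw [map_add, map_smul, map_add, MvPolynomial.smul_eval] at h2
  have h3 : MvPolynomial.eval x.1 (Φ 1) ≤ ‖restrict S (Φ 1)‖ :=
    (le_abs_self _).trans ((restrict S (Φ 1)).norm_coe_le_norm x)
  have h4 := mul_le_mul_of_nonneg_left h3 (norm_nonneg _ : 0 ≤ c)
  change |MvPolynomial.eval x.1 (Φ p)| ≤ _
  rw [abs_le]
  constructor <;> linarith

theorem extension_restrict {n : ℕ} {S : Set (Fin n → ℝ)} [CompactSpace S]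
    {Φ : MvPolynomial (Fin n) ℝ →ₗ[ℝ] MvPolynomial (Fin n) ℝ}
    (hΦ : IsNonnegativityPreserver S Φ) (p : MvPolynomial (Fin n) ℝ) :
    extension S Φ (restrict S p) = restrict S (Φ p) :=
  LinearMap.extendOfNorm_eq (denseRange_restrict S) ⟨_, norm_restrict_le hΦ⟩ p

theorem extension_unique {n : ℕ} {S : Set (Fin n → ℝ)} [CompactSpace S]
    {Φ : MvPolynomial (Fin n) ℝ →ₗ[ℝ] MvPolynomial (Fin n) ℝ}
    (hΦ : IsNonnegativityPreserver S Φ) (T : C(S, ℝ) →L[ℝ] C(S, ℝ))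
    (hT : ∀ p, T (restrict S p) = restrict S (Φ p)) : extension S Φ = T :=
  LinearMap.extendOfNorm_unique (denseRange_restrict S) _ (norm_restrict_le hΦ) T
    (LinearMap.ext hT)

theorem extension_nonneg {n : ℕ} {S : Set (Fin n → ℝ)} [CompactSpace S]
    {Φ : MvPolynomial (Fin n) ℝ →ₗ[ℝ] MvPolynomial (Fin n) ℝ}
    (hΦ : IsNonnegativityPreserver S Φ) (f : C(S, ℝ)) (hf : 0 ≤ f) : 0 ≤ extension S Φ f := by
  have hcl : IsClosed {g : C(S, ℝ) | 0 ≤ extension S Φ g} := by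
    have h : {g : C(S, ℝ) | 0 ≤ extension S Φ g} = ⋂ x : S, {g | 0 ≤ extension S Φ g x} := by
      ext g
      simp [ContinuousMap.le_def]
    rw [h]
    exact isClosed_iInter fun x => isClosed_le continuous_const
      ((continuous_eval_const (F := C(S, ℝ)) x).comp (extension S Φ).continuous)
  refine hcl.closure_subset (Metric.mem_closure_iff.2 fun ε hε => ?_)
  obtain ⟨p, hp⟩ := (denseRange_restrict S).exists_dist_lt
    (f + algebraMap ℝ C(S, ℝ) (ε / 2)) (half_pos hε)
  have hpt : ∀ x, |f x + ε / 2 - MvPolynomial.eval x.1 p| < ε / 2 := fun x =>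
    (ContinuousMap.dist_apply_le_dist (f := f + algebraMap ℝ C(S, ℝ) (ε / 2))
      (g := restrict S p) x).trans_lt hp
  refine ⟨restrict S p, ?_, ?_⟩
  · change 0 ≤ extension S Φ (restrict S p)
    rw [extension_restrict hΦ]
    intro x
    refine hΦ p (fun y hy => ?_) x x.2
    have h1 := (abs_lt.1 (hpt ⟨y, hy⟩)).2
    have h2 : 0 ≤ f ⟨y, hy⟩ := hf ⟨y, hy⟩
    simp only at h1
    linarith
  · refine (ContinuousMap.dist_lt_iff hε).2 fun x => ?_
    have := abs_lt.1 (hpt x)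
    rw [Real.dist_eq, abs_lt, restrict_apply]
    constructor <;> linarith

/-- The nonnegative Borel measures on `S` with all moments finite. -/
def MomentMeasure {n : ℕ} (S : Set (Fin n → ℝ)) : Type :=
  {μ : Measure S // ∀ p : MvPolynomial (Fin n) ℝ,
    Integrable (fun x : S => MvPolynomial.eval x.1 p) μ}

/-- The Dirac measure at `x`, as an element of `MomentMeasure S`. -/
noncomputable def diracMeasure {n : ℕ} {S : Set (Fin n → ℝ)} (x : S) : MomentMeasure S :=
  ⟨Measure.dirac x, fun _ => integrable_dirac enorm_lt_top⟩

/-- `T` is an adjoint map to `Φ`: `∫ Φ(p) dμ = ∫ p dT(μ)` for all polynomials `p` and all `μ`. -/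
def IsAdjointMap {n : ℕ} (S : Set (Fin n → ℝ))
    (Φ : MvPolynomial (Fin n) ℝ →ₗ[ℝ] MvPolynomial (Fin n) ℝ)
    (T : MomentMeasure S → MomentMeasure S) : Prop :=
  ∀ (p : MvPolynomial (Fin n) ℝ) (μ : MomentMeasure S),
    ∫ x : S, MvPolynomial.eval x.1 (Φ p) ∂μ.1 = ∫ x : S, MvPolynomial.eval x.1 p ∂(T μ).1

theorem MomentMeasure.isFiniteMeasure {n : ℕ} {S : Set (Fin n → ℝ)} (μ : MomentMeasure S) :
    IsFiniteMeasure μ.1 := by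
  have h := μ.2 1
  simp only [map_one] at h
  exact (integrable_const_iff_isFiniteMeasure one_ne_zero).1 h

theorem integrable_continuousMap {n : ℕ} {S : Set (Fin n → ℝ)} [CompactSpace S]
    (μ : Measure S) [IsFiniteMeasure μ] (f : C(S, ℝ)) : Integrable (fun x => f x) μ :=
  (BoundedContinuousFunction.mkOfCompact f).integrable μ

theorem exists_isAdjointMap {n : ℕ} {S : Set (Fin n → ℝ)} [CompactSpace S]
    {Φ : MvPolynomial (Fin n) ℝ →ₗ[ℝ] MvPolynomial (Fin n) ℝ}
    (hΦ : IsNonnegativityPreserver S Φ) : ∃ T, IsAdjointMap S Φ T := by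
  suffices h : ∀ μ : MomentMeasure S, ∃ ν : MomentMeasure S, ∀ p : MvPolynomial (Fin n) ℝ,
      ∫ x : S, MvPolynomial.eval x.1 (Φ p) ∂μ.1 = ∫ x : S, MvPolynomial.eval x.1 p ∂ν.1 by
    choose T hT using h
    exact ⟨T, fun p μ => hT μ p⟩
  intro μ
  have := μ.isFiniteMeasure
  let L : CompactlySupportedContinuousMap S ℝ →ₗ[ℝ] ℝ :=
    { toFun := fun f => ∫ x, extension S Φ (f : C(S, ℝ)) x ∂μ.1
      map_add' := fun f g => by
        have : ((f + g : CompactlySupportedContinuousMap S ℝ) : C(S, ℝ))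
          = (f : C(S, ℝ)) + (g : C(S, ℝ)) := rfl
        rw [this, map_add]
        exact integral_add (integrable_continuousMap _ _) (integrable_continuousMap _ _)
      map_smul' := fun c f => by
        have : ((c • f : CompactlySupportedContinuousMap S ℝ) : C(S, ℝ))
          = c • (f : C(S, ℝ)) := rfl
        rw [this, map_smul]
        exact integral_const_mul c _ }
  let Λ : CompactlySupportedContinuousMap S ℝ →ₚ[ℝ] ℝ := PositiveLinearMap.mk₀ L fun f hf =>
    integral_nonneg fun x => extension_nonneg hΦ (f : C(S, ℝ)) (fun y => hf y) x
  have hfin : IsFiniteMeasure (RealRMK.rieszMeasure Λ) :=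
    CompactSpace.isFiniteMeasure
  refine ⟨⟨RealRMK.rieszMeasure Λ, fun p => integrable_continuousMap _ (restrict S p)⟩,
    fun p => ?_⟩
  have h := RealRMK.integral_rieszMeasure Λ
    (CompactlySupportedContinuousMap.continuousMapEquiv (restrict S p))
  refine Eq.trans ?_ h.symm
  change _ = ∫ x, extension S Φ (restrict S p) x ∂μ.1
  rw [extension_restrict hΦ]
  rfl

theorem isAdjointMap_unique {n : ℕ} {S : Set (Fin n → ℝ)} [CompactSpace S]
    {Φ : MvPolynomial (Fin n) ℝ →ₗ[ℝ] MvPolynomial (Fin n) ℝ}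
    {T U : MomentMeasure S → MomentMeasure S} (hT : IsAdjointMap S Φ T)
    (hU : IsAdjointMap S Φ U) : T = U := by
  funext μ
  have hTf := (T μ).isFiniteMeasure
  have hUf := (U μ).isFiniteMeasure
  refine Subtype.ext (ext_of_forall_integral_eq_of_IsFiniteMeasure fun f => ?_)
  have hc : ∀ ν : Measure S, IsFiniteMeasure ν →
      Continuous fun g : C(S, ℝ) => ∫ x, g x ∂ν := fun ν _ => by
    refine (continuous_integral.comp (ContinuousMap.toLp (E := ℝ) 1 ν ℝ).continuous).congr
      fun g => ?_
    exact integral_congr_ae (ContinuousMap.coeFn_toLp ν g)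
  have h := (denseRange_restrict S).equalizer (hc _ hTf) (hc _ hUf)
    (funext fun p => (hT p μ).symm.trans (hU p μ))
  exact congrFun h f.toContinuousMap

/-- The unique adjoint map `Φ*` to a nonnegativity preserver on a compact set. -/
noncomputable def adjointMap {n : ℕ} {S : Set (Fin n → ℝ)} [CompactSpace S]
    {Φ : MvPolynomial (Fin n) ℝ →ₗ[ℝ] MvPolynomial (Fin n) ℝ}
    (hΦ : IsNonnegativityPreserver S Φ) : MomentMeasure S → MomentMeasure S :=
  (exists_isAdjointMap hΦ).choose

theorem isAdjointMap_adjointMap {n : ℕ} {S : Set (Fin n → ℝ)} [CompactSpace S]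
    {Φ : MvPolynomial (Fin n) ℝ →ₗ[ℝ] MvPolynomial (Fin n) ℝ}
    (hΦ : IsNonnegativityPreserver S Φ) : IsAdjointMap S Φ (adjointMap hΦ) :=
  (exists_isAdjointMap hΦ).choose_spec

/-- The function `x ↦ μ_x(A)` on `S`, where `μ_x = Φ*(δ_x)`. -/
noncomputable def adjointFun {n : ℕ} {S : Set (Fin n → ℝ)} [CompactSpace S]
    {Φ : MvPolynomial (Fin n) ℝ →ₗ[ℝ] MvPolynomial (Fin n) ℝ}
    (hΦ : IsNonnegativityPreserver S Φ) (A : Set S) (x : S) : ℝ :=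
  (adjointMap hΦ (diracMeasure x)).1.real A

/-- The closure, in the weak topology, of the image of the closed unit ball is weakly compact. -/
def IsWeaklyCompactOperator {X Y : Type*} [NormedAddCommGroup X] [NormedSpace ℝ X]
    [NormedAddCommGroup Y] [NormedSpace ℝ Y] (T : X →L[ℝ] Y) : Prop :=
  IsCompact (closure (toWeakSpace ℝ Y '' (T '' Metric.closedBall 0 1)))

end NonnegPreserver

/-!
The extension `T` of `Φ` to `C(S)` is given by the kernel `μ_x = Φ*(δ_x)`, that is
`T f x = ∫ f dμ_x` (`extension_apply_eq_integral`), so the equivalence is one about positive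
kernel operators on `C(K)` for a compact metric space `K`.

Suppose `x ↦ μ_x(A)` is continuous for every Borel set `A`. A finite measure `ν`
equivalent to the sum of the `μ_x` over a countable dense set of `x` dominates all of them
(`exists_finite_dominating`). By Dini's
theorem `μ_x(B_k) → 0` uniformly in `x` whenever the `B_k` decrease to a `ν`-null set, and hence
the `μ_x` are uniformly absolutely continuous with respect to `ν`
(`exists_uniform_absolutelyContinuous`). So `‖T f‖` is small when `f` is bounded by `2` and small
in `L²(ν)`. This makes `T` weakly compact (`isWeaklyCompactOperator_of_hilbert`): along an
ultrafilter on the unit ball of `C(K)` the functions converge weakly in the Hilbert space `L²(ν)`,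
by Mazur's theorem convex combinations of them converge in norm there, the images of these converge
in the norm of `C(K)`, and their limit is the weak limit of the images along the ultrafilter.

Conversely, suppose `T` is weakly compact. By regularity of the measures and Urysohn's lemma, the
function `x ↦ μ_x(A)` is a pointwise limit of functions `T f` with `‖f‖ ≤ 1`
(`exists_continuousMap_integral_near`). The weak closure of the image of the unit ball is compact
for pointwise convergence, hence closed in the space of all functions on `K`, so it contains
`x ↦ μ_x(A)`, which is therefore continuous.
-/

open MeasureTheory Filter Topology Set
open scoped ENNReal

namespace NonnegPreserver

/-! ### Weak compactness through a Hilbert space -/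

/-- In a regular space it suffices to test relative compactness on the ultrafilters that live on
the set itself, not on its closure. -/
theorem isCompact_closure_of_ultrafilter {α : Type*} [TopologicalSpace α] [RegularSpace α]
    {A : Set α} (h : ∀ 𝓤 : Ultrafilter α, A ∈ 𝓤 → ∃ y, (𝓤 : Filter α) ≤ 𝓝 y) :
    IsCompact (closure A) := by
  refine isCompact_iff_ultrafilter_le_nhds.2 fun 𝓤 h𝓤 => ?_
  have hA : closure A ∈ (𝓤 : Filter α) := le_principal_iff.1 h𝓤
  -- The sets whose interior belongs to `𝓤` form a filter `l`, which meets `A` because `𝓤`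
  -- contains the closure of `A`.
  let l : Filter α :=
    { sets := {s | interior s ∈ 𝓤}
      univ_sets := by
        rw [mem_ofPred_eq, interior_univ]
        exact univ_mem
      sets_of_superset := fun hs hst => mem_of_superset hs (interior_mono hst)
      inter_sets := fun hs ht => by
        rw [mem_ofPred_eq, interior_inter]
        exact inter_mem hs ht }
  have hne : NeBot (l ⊓ 𝓟 A) := by
    refine inf_principal_neBot_iff.2 fun V hV => ?_
    obtain ⟨x, hxV, hxA⟩ := 𝓤.neBot.nonempty_of_mem (inter_mem (show interior V ∈ 𝓤 from hV) hA)
    exact (mem_closure_iff.1 hxA _ isOpen_interior hxV).mono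
      (inter_subset_inter_left _ interior_subset)
  obtain ⟨y, hy⟩ := h (Ultrafilter.of (l ⊓ 𝓟 A))
    (Ultrafilter.of_le _ (mem_inf_of_right (mem_principal_self A)))
  refine ⟨y, ?_, ?_⟩
  · exact mem_closure_iff_ultrafilter.2 ⟨_, Ultrafilter.of_le (l ⊓ 𝓟 A)
      (mem_inf_of_right (mem_principal_self A)), hy⟩
  -- A closed neighbourhood of `y` outside `𝓤` would have its complement in `l`.
  refine (closed_nhds_basis y).ge_iff.2 fun C hC => ?_
  by_contra hCU
  have h1 : Cᶜ ∈ l := by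
    change interior Cᶜ ∈ 𝓤
    rw [hC.2.isOpen_compl.interior_eq]
    exact Ultrafilter.compl_mem_iff_notMem.2 hCU
  exact Ultrafilter.compl_mem_iff_notMem.1
    (Ultrafilter.of_le (l ⊓ 𝓟 A) (mem_inf_of_left h1)) (hy hC.1)

/-- Bounded ultrafilters on a Hilbert space converge weakly: this is the Banach–Alaoglu theorem,
transported by the Riesz representation. -/
theorem exists_weak_limit {α H : Type*} [NormedAddCommGroup H] [InnerProductSpace ℝ H]
    [CompleteSpace H] (𝓥 : Ultrafilter α) (u : α → H) {r : ℝ} (hu : ∀ᶠ a in 𝓥, ‖u a‖ ≤ r) :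
    ∃ g : H, ∀ φ : StrongDual ℝ H, Tendsto (fun a => φ (u a)) 𝓥 (𝓝 (φ g)) := by
  let e := InnerProductSpace.toDual ℝ H
  have hK := WeakDual.isCompact_closedBall (𝕜 := ℝ) (E := H) 0 r
  obtain ⟨ψ, -, hψ⟩ := hK.ultrafilter_le_nhds (𝓥.map fun a => StrongDual.toWeakDual (e (u a)))
    (by
      refine le_principal_iff.2 (mem_map.2 ?_)
      filter_upwards [hu] with a ha
      simpa [e] using ha)
  refine ⟨e.symm (WeakDual.toStrongDual ψ), fun φ => ?_⟩
  have h := ((WeakDual.eval_continuous (e.symm φ)).tendsto ψ).comp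
    (show Tendsto (fun a => StrongDual.toWeakDual (e (u a))) 𝓥 (𝓝 ψ) from hψ)
  have hφ : ∀ x, e x (e.symm φ) = φ x := fun x => by
    rw [InnerProductSpace.toDual_apply_apply, real_inner_comm,
      InnerProductSpace.toDual_symm_apply]
  rw [← hφ (e.symm _), e.apply_symm_apply]
  exact h.congr fun a => hφ (u a)

/-- If `‖T x‖` is small as soon as `‖x‖ ≤ 2` and `‖j x‖` is small in a Hilbert space, then `T` is
weakly compact. The bound `2` is the norm of a difference of two points of the unit ball. -/
theorem isWeaklyCompactOperator_of_hilbert {X Y H : Type*} [NormedAddCommGroup X] [NormedSpace ℝ X]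
    [NormedAddCommGroup Y] [NormedSpace ℝ Y] [CompleteSpace Y]
    [NormedAddCommGroup H] [InnerProductSpace ℝ H] [CompleteSpace H]
    (T : X →L[ℝ] Y) (j : X →L[ℝ] H)
    (hTj : ∀ ε > 0, ∃ δ > 0, ∀ x, ‖x‖ ≤ 2 → ‖j x‖ ≤ δ → ‖T x‖ ≤ ε) :
    IsWeaklyCompactOperator T := by
  refine isCompact_closure_of_ultrafilter fun 𝓤 h𝓤 => ?_
  rw [image_image] at h𝓤
  let 𝓥 := Ultrafilter.ofComapInfPrincipal h𝓤
  have hball : Metric.closedBall (0 : X) 1 ∈ 𝓥 := Ultrafilter.ofComapInfPrincipal_mem h𝓤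
  have hmap : 𝓥.map (fun x => toWeakSpace ℝ Y (T x)) = 𝓤 :=
    Ultrafilter.ofComapInfPrincipal_eq_of_map h𝓤
  obtain ⟨g, hg⟩ := exists_weak_limit 𝓥 j (r := ‖j‖) (by
    filter_upwards [hball] with x hx
    exact j.unit_le_opNorm x (by simpa using hx))
  -- Mazur: `g` is in the norm closure of `j F` for every convex member `F` of the ultrafilter.
  have hmazur : ∀ F ∈ 𝓥, Convex ℝ F → g ∈ closure (j '' F) := by
    intro F hF hconv
    by_contra hgF
    obtain ⟨φ, u, hu, hFu⟩ := geometric_hahn_banach_point_closed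
      (hconv.linear_image j.toLinearMap).closure isClosed_closure hgF
    obtain ⟨x, hx, hxF⟩ := (((hg φ).eventually (gt_mem_nhds hu)).and hF).exists
    exact lt_asymm hx (hFu _ (subset_closure (mem_image_of_mem j hxF)))
  have hne : ∀ F ∈ 𝓥, Convex ℝ F → NeBot (comap j (𝓝 g) ⊓ 𝓟 F) := by
    intro F hF hconv
    have h := mem_closure_iff_clusterPt.1 (hmazur F hF hconv)
    rwa [ClusterPt, ← map_principal, ← Filter.push_pull', map_neBot_iff] at h
  -- On the unit ball, `T x` converges in norm as `j x → g`; the limit is the weak limit sought.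
  let l := comap j (𝓝 g) ⊓ 𝓟 (Metric.closedBall (0 : X) 1)
  have : NeBot l := hne _ hball (convex_closedBall _ _)
  have hcauchy : Cauchy (map T l) := by
    rw [Metric.cauchy_iff]
    refine ⟨inferInstance, fun ε hε => ?_⟩
    obtain ⟨δ, hδ, h⟩ := hTj (ε / 2) (half_pos hε)
    refine ⟨T '' (j ⁻¹' Metric.ball g (δ / 2) ∩ Metric.closedBall 0 1), image_mem_map
      (inter_mem_inf (preimage_mem_comap (Metric.ball_mem_nhds _ (half_pos hδ)))
        (mem_principal_self _)), ?_⟩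
    rintro _ ⟨x, ⟨hx, hx1⟩, rfl⟩ _ ⟨y, ⟨hy, hy1⟩, rfl⟩
    rw [dist_eq_norm, ← map_sub]
    refine (h (x - y) ?_ ?_).trans_lt (half_lt_self hε)
    · rw [mem_closedBall_zero_iff] at hx1 hy1
      exact (norm_sub_le _ _).trans (by linarith)
    · rw [map_sub, ← dist_eq_norm]
      have h1 : dist (j x) g < δ / 2 := hx
      have h2 : dist (j y) g < δ / 2 := hy
      exact (dist_triangle_right _ _ g).trans (by linarith)
  obtain ⟨h, hh⟩ := CompleteSpace.complete hcauchy
  have hT : Tendsto T l (𝓝 h) := hh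
  -- Every half-space whose preimage belongs to the ultrafilter contains `h`.
  have hhalf : ∀ (φ : StrongDual ℝ Y) (c : ℝ), (∀ᶠ x in 𝓥, c ≤ φ (T x)) → c ≤ φ h := by
    intro φ c hc
    have hconv : Convex ℝ ({x | c ≤ φ (T x)} ∩ Metric.closedBall (0 : X) 1) :=
      (convex_halfSpace_ge (φ.comp T).toLinearMap.isLinear c).inter (convex_closedBall _ _)
    have := hne _ (inter_mem hc hball) hconv
    rw [← inf_principal, inf_comm (𝓟 {x | c ≤ φ (T x)}), ← inf_assoc] at this
    refine ge_of_tendsto (f := fun x => φ (T x)) (x := l ⊓ 𝓟 {x | c ≤ φ (T x)})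
      ((φ.continuous.tendsto h).comp (hT.mono_left inf_le_left)) ?_
    exact mem_inf_of_right (mem_principal_self _)
  have hweak : ∀ φ : StrongDual ℝ Y, Tendsto (fun x => φ (T x)) 𝓥 (𝓝 (φ h)) := by
    refine fun φ => tendsto_order.2 ⟨fun c hc => ?_, fun c hc => ?_⟩
    · by_contra hcon
      have := hhalf (-φ) (-c) (by
        filter_upwards [Ultrafilter.eventually_not.2 hcon] with x hx
        simpa using hx)
      simp at this
      linarith
    · by_contra hcon
      have := hhalf φ c (by
        filter_upwards [Ultrafilter.eventually_not.2 hcon] with x hx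
        simpa using hx)
      linarith
  refine ⟨toWeakSpace ℝ Y h, ?_⟩
  rw [← hmap]
  have hinj : Function.Injective (topDualPairing ℝ Y).flip := fun (a b : Y) hab =>
    (SeparatingDual.eq_iff_forall_dual_eq (R := ℝ)).2 fun φ => DFunLike.congr_fun hab φ
  exact (WeakBilin.tendsto_iff_forall_eval_tendsto _ hinj).2 hweak

/-! ### Families of measures depending continuously on a parameter -/

/-- A family of finite measures that is setwise continuous in a separable parameter is dominated
by a single finite measure. -/
theorem exists_finite_dominating {X Ω : Type*} [TopologicalSpace X]
    [TopologicalSpace.SeparableSpace X] [MeasurableSpace Ω] (μ : X → Measure Ω)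
    [∀ x, IsFiniteMeasure (μ x)]
    (hc : ∀ A, MeasurableSet A → Continuous fun x => (μ x).real A) :
    ∃ ν : Measure Ω, IsFiniteMeasure ν ∧ ∀ x, μ x ≪ ν := by
  obtain ⟨D, hDc, hD⟩ := TopologicalSpace.exists_countable_dense X
  have := hDc.to_subtype
  refine ⟨(Measure.sum fun d : D => μ d).toFinite, inferInstance, fun x => ?_⟩
  refine Measure.AbsolutelyContinuous.trans (Measure.AbsolutelyContinuous.mk fun A hA h0 => ?_)
    (absolutelyContinuous_toFinite _)
  rw [Measure.sum_apply _ hA, ENNReal.tsum_eq_zero] at h0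
  have hzero : (fun x => (μ x).real A) = fun _ => 0 :=
    (hc A hA).ext_on hD continuous_const fun d hd => by simp [Measure.real, h0 ⟨d, hd⟩]
  exact (measureReal_eq_zero_iff (measure_ne_top _ _)).1 (congrFun hzero x)

/-- A family of finite measures that is setwise continuous in a compact parameter and dominated by
`ν` is uniformly absolutely continuous with respect to `ν`. -/
theorem exists_uniform_absolutelyContinuous {X Ω : Type*} [TopologicalSpace X] [CompactSpace X]
    [MeasurableSpace Ω] (μ : X → Measure Ω) [∀ x, IsFiniteMeasure (μ x)]
    (hc : ∀ A, MeasurableSet A → Continuous fun x => (μ x).real A)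
    (ν : Measure Ω) (hν : ∀ x, μ x ≪ ν) {ε : ℝ} (hε : 0 < ε) :
    ∃ δ : ℝ≥0∞, δ ≠ 0 ∧ ∀ A, MeasurableSet A → ν A ≤ δ → ∀ x, (μ x).real A ≤ ε := by
  by_contra! hcon
  obtain ⟨δ, hδ, hsum⟩ := ENNReal.exists_pos_sum_of_countable' (ε := 1) one_ne_zero ℕ
  choose A hA hAδ x hx using fun k => hcon (δ k) (hδ k).ne'
  let B : ℕ → Set Ω := fun k => ⋃ j ≥ k, A j
  have hB : ∀ k, MeasurableSet (B k) := fun k =>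
    MeasurableSet.iUnion fun j => MeasurableSet.iUnion fun _ => hA j
  have hanti : Antitone B := fun k l hkl =>
    biUnion_subset_biUnion_left fun j (hj : l ≤ j) => hkl.trans hj
  -- By the Borel–Cantelli lemma, `⋂ k, B k = limsup A` is a null set.
  have hzero : ν (⋂ k, B k) = 0 := by
    have h := measure_limsup_atTop_eq_zero (μ := ν) (s := A)
      ((ENNReal.tsum_le_tsum hAδ).trans_lt (hsum.trans ENNReal.one_lt_top)).ne
    rwa [limsup_eq_iInf_iSup_of_nat] at h
  have hlim : ∀ y, Tendsto (fun k => (μ y).real (B k)) atTop (𝓝 0) := fun y => by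
    have h := tendsto_measure_iInter_atTop (μ := μ y) (fun k => (hB k).nullMeasurableSet) hanti
      ⟨0, measure_ne_top _ _⟩
    rw [hν y hzero] at h
    exact (ENNReal.tendsto_toReal ENNReal.zero_ne_top).comp h
  have hdini := Antitone.tendstoUniformly_of_forall_tendsto (F := fun k y => (μ y).real (B k))
    (f := fun _ => 0) (fun k => hc _ (hB k))
    (fun k l hkl y => measureReal_mono (hanti hkl) (measure_ne_top _ _)) continuous_const hlim
  obtain ⟨k, hk⟩ := ((Metric.tendstoUniformly_iff.1 hdini) ε hε).exists
  have h1 := hk (x k)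
  rw [dist_zero_left, Real.norm_of_nonneg measureReal_nonneg] at h1
  exact lt_asymm (hx k) ((measureReal_mono (subset_biUnion_of_mem (u := A) (le_refl k))
    (measure_ne_top _ _)).trans_lt h1)

/-! ### Operators on continuous functions given by a kernel -/

/-- Integration against a finite measure is continuous on `C(K)`. -/
theorem continuous_integral_continuousMap {K : Type*} [TopologicalSpace K] [CompactSpace K]
    [MeasurableSpace K] [BorelSpace K] [SecondCountableTopologyEither K ℝ] (μ : Measure K)
    [IsFiniteMeasure μ] :
    Continuous fun g : C(K, ℝ) => ∫ x, g x ∂μ :=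
  (continuous_integral.comp (ContinuousMap.toLp (E := ℝ) 1 μ ℝ).continuous).congr fun g =>
    integral_congr_ae (ContinuousMap.coeFn_toLp μ g)

section Kernel

variable {K : Type*} [MetricSpace K] [CompactSpace K] [MeasurableSpace K] [BorelSpace K]

/-- If `x ↦ μ x A` is continuous for all Borel sets `A`, then the operator on `C(K)` with kernel
`μ` is weakly compact. -/
theorem isWeaklyCompactOperator_of_continuous_measure (T : C(K, ℝ) →L[ℝ] C(K, ℝ))
    (μ : K → Measure K) [∀ x, IsFiniteMeasure (μ x)] (hT : ∀ f x, T f x = ∫ y, f y ∂μ x)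
    (hc : ∀ A, MeasurableSet A → Continuous fun x => (μ x).real A) :
    IsWeaklyCompactOperator T := by
  obtain ⟨ν, hνfin, hν⟩ := exists_finite_dominating μ hc
  refine isWeaklyCompactOperator_of_hilbert T (ContinuousMap.toLp (E := ℝ) 2 ν ℝ) fun ε hε => ?_
  obtain ⟨C, hC⟩ : ∃ C, ∀ x, (μ x).real univ ≤ C := by
    obtain ⟨C, hC⟩ := (isCompact_range (hc univ MeasurableSet.univ)).bddAbove
    exact ⟨C, fun x => hC (mem_range_self x)⟩
  obtain ⟨η, hη, hηC⟩ : ∃ η > 0, η * C ≤ ε / 2 := by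
    refine ⟨ε / (2 * (|C| + 1)), by positivity, ?_⟩
    rw [div_mul_eq_mul_div, div_le_div_iff₀ (by positivity) two_pos]
    nlinarith [le_abs_self C]
  obtain ⟨δ, hδ, hδμ⟩ := exists_uniform_absolutelyContinuous μ hc ν hν (ε := ε / 4) (by positivity)
  obtain ⟨ρ, hρ, hρδ⟩ : ∃ ρ > 0, (ENNReal.ofReal η)⁻¹ ^ 2 * ENNReal.ofReal ρ ^ 2 ≤ δ := by
    obtain ⟨d, hd, hdδ⟩ := ENNReal.lt_iff_exists_nnreal_btwn.1 (pos_iff_ne_zero.2 hδ)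
    have hd' : (0 : ℝ) < d := by exact_mod_cast hd
    refine ⟨η * √d, by positivity, le_trans (le_of_eq ?_) hdδ.le⟩
    rw [← ENNReal.ofReal_inv_of_pos hη, ← ENNReal.ofReal_pow (by positivity),
      ← ENNReal.ofReal_pow (by positivity), ← ENNReal.ofReal_mul (by positivity), mul_pow,
      Real.sq_sqrt hd'.le, ← mul_assoc, ← mul_pow, inv_mul_cancel₀ hη.ne', one_pow, one_mul,
      ENNReal.ofReal_coe_nnreal]
  refine ⟨ρ, hρ, fun f hf hfρ => (ContinuousMap.norm_le _ hε.le).2 fun x => ?_⟩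
  -- Off `A` the integrand is at most `η`, and on `A` it is at most `2`.
  let A : Set K := {y | η ≤ ‖f y‖}
  have hA : MeasurableSet A := (isClosed_le continuous_const f.continuous.norm).measurableSet
  -- Chebyshev's inequality
  have hνA : ν A ≤ δ := by
    refine le_trans ?_ hρδ
    have h := meas_ge_le_mul_pow_eLpNorm_enorm ν two_ne_zero ENNReal.ofNat_ne_top
      (f := f) f.continuous.aestronglyMeasurable (ε := ENNReal.ofReal η) (by simpa using hη)
      (by simp)
    have hnorm : eLpNorm f 2 ν ≤ ENNReal.ofReal ρ := by
      rw [← eLpNorm_congr_ae (ContinuousMap.coeFn_toLp (p := 2) (𝕜 := ℝ) ν f), ← Lp.enorm_def,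
        ← ofReal_norm]
      exact ENNReal.ofReal_le_ofReal hfρ
    have hset : {y | ENNReal.ofReal η ≤ ‖f y‖ₑ} = A := by
      ext y
      rw [mem_ofPred_eq, ← ofReal_norm, ENNReal.ofReal_le_ofReal_iff (norm_nonneg _)]
      rfl
    rw [hset, ENNReal.toReal_ofNat, ENNReal.rpow_ofNat, ENNReal.rpow_ofNat] at h
    exact h.trans (by gcongr)
  have hbound : ∀ y, ‖f y‖ ≤ η + A.indicator (fun _ => 2) y := fun y => by
    by_cases hy : y ∈ A
    · rw [indicator_of_mem hy]
      linarith [f.norm_coe_le_norm y]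
    · rw [indicator_of_notMem hy, add_zero]
      exact (not_le.1 hy).le
  calc ‖T f x‖ = ‖∫ y, f y ∂μ x‖ := by rw [hT]
    _ ≤ ∫ y, (η + A.indicator (fun _ => 2) y) ∂μ x :=
      norm_integral_le_of_norm_le ((integrable_const _).add
        ((integrable_const _).indicator hA)) (Eventually.of_forall hbound)
    _ = η * (μ x).real univ + 2 * (μ x).real A := by
      rw [integral_add (integrable_const _) ((integrable_const _).indicator hA),
        integral_indicator_const _ hA, integral_const, smul_eq_mul, smul_eq_mul]
      ring
    _ ≤ ε := by
      have h1 := mul_le_mul_of_nonneg_left (hC x) hη.le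
      have h2 := hδμ A hA hνA x
      linarith

/-- For a Borel set `A` and finitely many finite measures, a continuous function with values in
`[0, 1]` has integrals close to the measures of `A`. -/
theorem exists_continuousMap_integral_near {ι : Type*} (I : Finset ι) (μ : ι → Measure K)
    [∀ i, IsFiniteMeasure (μ i)] {A : Set K} (hA : MeasurableSet A) {ε : ℝ} (hε : 0 < ε) :
    ∃ f : C(K, ℝ), ‖f‖ ≤ 1 ∧ ∀ i ∈ I, |∫ y, f y ∂μ i - (μ i).real A| < ε := by
  -- Inner and outer regularity of the sum of the measures, then Urysohn's lemma.
  let ν : Measure K := ∑ i ∈ I, μ i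
  have hε' : ENNReal.ofReal (ε / 2) ≠ 0 := by simpa using hε
  obtain ⟨F, hFA, hF, hνF⟩ := hA.exists_isClosed_sdiff_lt (measure_ne_top ν A) hε'
  obtain ⟨U, hAU, hU, -, hνU⟩ := hA.exists_isOpen_sdiff_lt (measure_ne_top ν A) hε'
  obtain ⟨f, hf0, hf1, hf⟩ := exists_continuous_zero_one_of_isClosed hU.isClosed_compl hF
    (disjoint_compl_left_iff_subset.2 (hFA.trans hAU))
  refine ⟨f, (ContinuousMap.norm_le _ zero_le_one).2 fun y => ?_, fun i hi => ?_⟩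
  · rw [Real.norm_of_nonneg (hf y).1]
    exact (hf y).2
  have hle : μ i ≤ ν := by
    exact Finset.single_le_sum (f := μ) (fun _ _ => Measure.zero_le _) hi
  have hsmall : ∀ B, ν B < ENNReal.ofReal (ε / 2) → (μ i).real B < ε / 2 := fun B hB =>
    ENNReal.toReal_lt_of_lt_ofReal ((hle B).trans_lt hB)
  have hfi := (BoundedContinuousFunction.mkOfCompact f).integrable (μ i)
  have h1 : (μ i).real F ≤ ∫ y, f y ∂μ i := by
    rw [← integral_indicator_one hF.measurableSet]
    refine integral_mono ((integrable_const _).indicator hF.measurableSet) hfi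
      fun y => ?_
    by_cases hy : y ∈ F
    · rw [indicator_of_mem hy, hf1 hy]
    · rw [indicator_of_notMem hy]
      exact (hf y).1
  have h2 : ∫ y, f y ∂μ i ≤ (μ i).real U := by
    rw [← integral_indicator_one hU.measurableSet]
    refine integral_mono hfi ((integrable_const _).indicator hU.measurableSet) fun y => ?_
    by_cases hy : y ∈ U
    · rw [indicator_of_mem hy]
      exact (hf y).2
    · rw [indicator_of_notMem hy]
      exact (hf0 hy).le
  have h3 := hsmall _ hνF
  have h4 := hsmall _ hνU
  rw [measureReal_sdiff hFA hF.measurableSet] at h3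
  rw [measureReal_sdiff hAU hA] at h4
  rw [abs_lt]
  constructor <;> linarith

/-- If the operator on `C(K)` with kernel `μ` is weakly compact, then `x ↦ μ x A` is continuous
for all Borel sets `A`. -/
theorem continuous_measure_of_isWeaklyCompactOperator (T : C(K, ℝ) →L[ℝ] C(K, ℝ))
    (μ : K → Measure K) [∀ x, IsFiniteMeasure (μ x)] (hT : ∀ f x, T f x = ∫ y, f y ∂μ x)
    (hw : IsWeaklyCompactOperator T) {A : Set K} (hA : MeasurableSet A) :
    Continuous fun x => (μ x).real A := by
  -- The passage from the weak topology to the topology of pointwise convergence.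
  let ev : WeakSpace ℝ C(K, ℝ) → K → ℝ := fun f => ((toWeakSpace ℝ C(K, ℝ)).symm f : C(K, ℝ))
  have hev : Continuous ev := continuous_pi fun x =>
    WeakBilin.eval_continuous (topDualPairing ℝ C(K, ℝ)).flip (ContinuousMap.evalCLM ℝ x)
  suffices h : (fun x => (μ x).real A) ∈
      ev '' closure (toWeakSpace ℝ C(K, ℝ) '' (T '' Metric.closedBall 0 1)) by
    obtain ⟨f, -, hf⟩ := h
    rw [← hf]
    exact ((toWeakSpace ℝ C(K, ℝ)).symm f).continuous
  -- The image is compact, hence closed, in the topology of pointwise convergence.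
  refine (hw.image hev).isClosed.closure_subset_iff.2 (image_mono subset_closure) ?_
  refine mem_closure_iff.2 fun O hO hAO => ?_
  obtain ⟨I, u, hu, hIu⟩ := isOpen_pi_iff.1 hO _ hAO
  obtain ⟨ε, hεI, hε⟩ : ∃ ε : ℝ, (∀ x ∈ I, Metric.ball ((μ x).real A) ε ⊆ u x) ∧ 0 < ε := by
    have h : ∀ᶠ ε : ℝ in 𝓝[>] 0, ∀ x ∈ I, Metric.ball ((μ x).real A) ε ⊆ u x := by
      refine (Filter.eventually_all_finset I).2 fun x hx => ?_
      obtain ⟨r, hr, hru⟩ := Metric.isOpen_iff.1 (hu x hx).1 _ (hu x hx).2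
      filter_upwards [Ioo_mem_nhdsGT hr] with ε hε
      exact (Metric.ball_subset_ball hε.2.le).trans hru
    exact (h.and self_mem_nhdsWithin).exists
  obtain ⟨f, hf, hfI⟩ := exists_continuousMap_integral_near I μ hA hε
  refine ⟨T f, hIu fun x hx => hεI x hx ?_, _, ⟨_, ⟨f, by simpa using hf, rfl⟩, rfl⟩, rfl⟩
  rw [hT]
  exact hfI x hx

end Kernel

/-! ### The kernel of the extension -/

/-- The measures `Φ*(δ_x)` are the kernel of the extension of `Φ` to `C(S)`. -/
theorem extension_apply_eq_integral {n : ℕ} {S : Set (Fin n → ℝ)} [CompactSpace S]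
    {Φ : MvPolynomial (Fin n) ℝ →ₗ[ℝ] MvPolynomial (Fin n) ℝ}
    (hΦ : IsNonnegativityPreserver S Φ) (f : C(S, ℝ)) (x : S) :
    extension S Φ f x = ∫ y, f y ∂(adjointMap hΦ (diracMeasure x)).1 := by
  have := (adjointMap hΦ (diracMeasure x)).isFiniteMeasure
  refine congrFun ((denseRange_restrict S).equalizer
    ((continuous_eval_const x).comp (extension S Φ).continuous)
    (continuous_integral_continuousMap (adjointMap hΦ (diracMeasure x)).1)
    (funext fun p => ?_)) f
  refine Eq.trans ?_ (isAdjointMap_adjointMap hΦ p (diracMeasure x))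
  refine Eq.trans ?_ (integral_dirac _ x).symm
  exact DFunLike.congr_fun (extension_restrict hΦ p) x

end NonnegPreserver

theorem mainTheorem6 {n : ℕ} (S : Set (Fin n → ℝ)) [CompactSpace S]
    (hS : NonnegPreserver.IsZariskiDense S)
    (Φ : MvPolynomial (Fin n) ℝ →ₗ[ℝ] MvPolynomial (Fin n) ℝ)
    (hΦ : NonnegPreserver.IsNonnegativityPreserver S Φ) :
    (∀ A : Set S, MeasurableSet A → Continuous (NonnegPreserver.adjointFun hΦ A)) ↔
      NonnegPreserver.IsWeaklyCompactOperator (NonnegPreserver.extension S Φ) := by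
  have := fun x : S =>
    (NonnegPreserver.adjointMap hΦ (NonnegPreserver.diracMeasure x)).isFiniteMeasure
  exact ⟨NonnegPreserver.isWeaklyCompactOperator_of_continuous_measure _ _
      (NonnegPreserver.extension_apply_eq_integral hΦ),
    fun h _ hA => NonnegPreserver.continuous_measure_of_isWeaklyCompactOperator _ _
      (NonnegPreserver.extension_apply_eq_integral hΦ) h hA⟩
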